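/- **Setting.** A network has $n$ sensors of $K$ types, with $n_k\ge 1$ sensors of type $k\in\{1,\dots,K\}$ and $\sum_k n_k=n$. For every type $k$ let $p_{0,k}$ and $p_{1,k}$ be probability distributions on a common measurable space $\mathcal X$: a sensor of type $k$ generates samples from $p_{1,k}$ if it is affected by an anomaly and from $p_{0,k}$ otherwise. The sensors are arranged in $2K$ groups: group $k\le K$ consists of the unaffected sensors of type $k$, and group $K+k$ of the affected sensors of type $k$. For $s\in\{0,1,\dots,K\}$ let $\mathcal S_{n,s}$ be the set of labels $\sigma:\{1,\dots,n\}\to\{1,\dots,2K\}$ such that: if $s=0$, then $|\sigma^{-1}(k)|=n_k$ and $|\sigma^{-1}(K+k)|=0$ for all $k\le K$; if $s\ge1$, then $|\sigma^{-1}(k)|=n_k$ and $|\sigma^{-1}(K+k)|=0$ for all $k\le K$ with $k\ne s$, $|\sigma^{-1}(s)|=n_s-1$, and $|\sigma^{-1}(K+s)|=1$. For a label $\sigma\in\mathcal S_{n,s}$ let $\mathbb P^{s}_{\sigma}$ be the product measure on $\mathcal X^n$ whose $i$-th factor is $p_{0,\sigma(i)}$ if $\sigma(i)\le K$ and $p_{1,\sigma(i)-K}$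 if $\sigma(i)>K$. At each time $t=1,2,\dots$ an unlabeled sample vector $X^n[t]\in\mathcal X^n$ is observed. An anomaly emerges at an unknown time $\nu\ge1$. Its trajectory $\boldsymbol S=(S[t])_{t\ge1}$ has $S[t]=0$ for $t<\nu$ and $S[t]\in\{1,\dots,K\}$ arbitrary for $t\ge\nu$ (the type of the one affected sensor). Given $\nu$, $\boldsymbol S$ and labels $\Omega_{\boldsymbol S}=(\sigma_t)_{t\ge1}$ with $\sigma_t\in\mathcal S_{n,S[t]}$, the vectors $X^n[t]$ are independent with $X^n[t]\sim\mathbb P^{S[t]}_{\sigma_t}$; $\mathbb E^{\boldsymbol S,\nu}_{\Omega_{\boldsymbol S}}$ denotes the corresponding expectation. When there is no change ($S[t]=0$ for all $t$, labels $\Omega=(\sigma_t)_{t\ge1}$ with $\sigma_t\in\mathcal S_{n,0}$), it is denoted by $\mathbb E^\infty_\Omega$. For a stopping time $\tau$ (possibly infinite) of the filtration generated by $X^n[1],X^n[2],\dots$ define $$\mathrm{WADD}(\tau)=\sup_{\nu\ge1}\ \sup_{\boldsymbol S}\ \sup_{\Omega_{\boldsymbol S}}\ \operatorname{ess\,sup}\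 \mathbb E^{\boldsymbol S,\nu}_{\Omega_{\boldsymbol S}}\big[(\tau-\nu)^+\,\big|\,X^n[1],\dots,X^n[\nu-1]\big],\qquad \mathrm{WARL}(\tau)=\inf_{\Omega}\mathbb E^\infty_\Omega[\tau].$$ Let $\widetilde{\mathbb P}_0=\frac1{|\mathcal S_{n,0}|}\sum_{\sigma\in\mathcal S_{n,0}}\mathbb P^{0}_{\sigma}$ and $\widetilde{\mathbb P}^k=\frac1{|\mathcal S_{n,k}|}\sum_{\sigma\in\mathcal S_{n,k}}\mathbb P^{k}_{\sigma}$ for $1\le k\le K$. For a probability vector $\boldsymbol\beta=(\beta_1,\dots,\beta_K)$ put $\widetilde{\mathbb P}^{\boldsymbol\beta}=\sum_k\beta_k\widetilde{\mathbb P}^k$ and let $I_{\boldsymbol\beta}=D(\widetilde{\mathbb P}^{\boldsymbol\beta}\,\|\,\widetilde{\mathbb P}_0)\in[0,\infty]$ be the Kullback-Leibler divergence. Let $\boldsymbol\beta^*$ minimize $I_{\boldsymbol\beta}$ over all probability vectors, and suppose $I_{\boldsymbol\beta^*}>0$. **Theorem.** As $\gamma\to\infty$, $$\inf_{\tau:\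 \mathrm{WARL}(\tau)\ge\gamma}\mathrm{WADD}(\tau)\ \ge\ \frac{\log\gamma}{I_{\boldsymbol\beta^*}}\,(1+o(1)),$$ where the infimum is over stopping times $\tau$ and the $o(1)$ term depends only on $\gamma$ (for the given $n_k$, $p_{\theta,k}$ and $\boldsymbol\beta^*$), not on $\tau$. (If $I_{\boldsymbol\beta^*}=\infty$, the right-hand side is read as $0$.) -/

import Mathlib

open MeasureTheory ProbabilityTheory Filter
open scoped ENNReal Topology

namespace UnlabeledQCD

/-- The size of each of the `2K` sensor groups when there are `m k` sensors of type `k` and the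
affected sensor has type `s` (`s = none`: no anomaly).  The group `Sum.inl k` consists of the
unaffected sensors of type `k`, the group `Sum.inr k` of the affected sensors of type `k`. -/
def groupSize {K : ℕ} (m : Fin K → ℕ) (s : Option (Fin K)) : Fin K ⊕ Fin K → ℕ
  | Sum.inl k => if s = some k then m k - 1 else m k
  | Sum.inr k => if s = some k then 1 else 0

/-- The labels: all ways to associate the `n` samples received at one time step with groups, such
that every group gets as many samples as it has sensors. -/
def labels (n : ℕ) {K : ℕ} (m : Fin K → ℕ) (s : Option (Fin K)) :
    Finset (Fin n → Fin K ⊕ Fin K) :=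
  Finset.univ.filter fun σ => ∀ g, (Finset.univ.filter fun i => σ i = g).card = groupSize m s g

noncomputable section

variable {X : Type*} [MeasurableSpace X] {n K : ℕ}

/-- The distribution of a sample from a sensor in a given group; `p 0 k` and `p 1 k` are the
distributions for an unaffected and an affected sensor of type `k`. -/
def groupDist (p : Fin 2 → Fin K → Measure X) : Fin K ⊕ Fin K → Measure X
  | Sum.inl k => p 0 k
  | Sum.inr k => p 1 k

/-- The distribution of the vector of samples at one time step, given the label `σ`. -/
def labelDist (p : Fin 2 → Fin K → Measure X) (σ : Fin n → Fin K ⊕ Fin K) :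
    Measure (Fin n → X) :=
  Measure.pi fun i => groupDist p (σ i)

/-- The uniform mixture, over all labels, of the distributions of the vector of samples when the
affected sensor has type `s` (`s = none`: no anomaly). -/
def mixture (n : ℕ) (p : Fin 2 → Fin K → Measure X) (m : Fin K → ℕ) (s : Option (Fin K)) :
    Measure (Fin n → X) :=
  ((labels n m s).card : ℝ≥0∞)⁻¹ • ∑ σ ∈ labels n m s, labelDist p σ

/-- The mixture of the post-change mixtures with weights `β`. -/
def weightedMixture (n : ℕ) (p : Fin 2 → Fin K → Measure X) (m : Fin K → ℕ) (β : Fin K → ℝ) :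
    Measure (Fin n → X) :=
  ∑ k, ENNReal.ofReal (β k) • mixture n p m (some k)

/-- The Kullback-Leibler divergence of the weighted mixture from the pre-change mixture. -/
def weightedDiv (n : ℕ) (p : Fin 2 → Fin K → Measure X) (m : Fin K → ℕ) (β : Fin K → ℝ) :
    ℝ≥0∞ :=
  InformationTheory.klDiv (weightedMixture n p m β) (mixture n p m none)

/-- The law of the sequence of sample vectors under the sequence of labels `Ω`: independent over
time.  In all sequences indexed by `ℕ` the entry with index `t` belongs to the time `t + 1`, so that
the observations start at time `1`. -/
def law (p : Fin 2 → Fin K → Measure X) (Ω : ℕ → Fin n → Fin K ⊕ Fin K) :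
    Measure (ℕ → Fin n → X) :=
  Measure.infinitePi fun t => labelDist p (Ω t)

/-- The filtration of the observations: the σ-algebra at time `t` is generated by the sample vectors
at the times `1, …, t`; it is trivial for `t = 0`. -/
def hist (X : Type*) [MeasurableSpace X] (n : ℕ) :
    Filtration ℕ (MeasurableSpace.pi : MeasurableSpace (ℕ → Fin n → X)) where
  seq t := cylinderEvents (Set.Iio t)
  mono' _ _ h := cylinderEvents_mono (Set.Iio_subset_Iio h)
  le' _ := cylinderEvents_le_pi

/-- `S` is a trajectory of an anomaly that emerges at time `ν`: there is no affected sensor exactly at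
the times before `ν`, and the types of the affected sensors from `ν` on are arbitrary. -/
def IsTrajectory (ν : ℕ) (S : ℕ → Option (Fin K)) : Prop :=
  ∀ t, S t = none ↔ t + 1 < ν

/-- The delay `(τ - ν)⁺`, which is infinite if `τ` is. -/
def delay (τ : (ℕ → Fin n → X) → ℕ∞) (ν : ℕ) (x : ℕ → Fin n → X) : ℝ≥0∞ :=
  (τ x : ℝ≥0∞) - (ν : ℝ≥0∞)

/-- The worst-case average detection delay: the supremum over the change points, the trajectories
and the labels of the essential supremum of the conditional expectation of the delay given the
observations before the change point. -/
def WADD (p : Fin 2 → Fin K → Measure X) (m : Fin K → ℕ) (τ : (ℕ → Fin n → X) → ℕ∞) : ℝ≥0∞ :=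
  ⨆ (ν : ℕ) (_ : 1 ≤ ν) (S : ℕ → Option (Fin K)) (_ : IsTrajectory ν S)
    (Ω : ℕ → Fin n → Fin K ⊕ Fin K) (_ : ∀ t, Ω t ∈ labels n m (S t)),
    essSup (condLExp (hist X n (ν - 1)) (law p Ω) (delay τ ν)) (law p Ω)

/-- The worst-case average running length: the infimum, over all labels without anomaly, of the
expectation of `τ`. -/
def WARL (p : Fin 2 → Fin K → Measure X) (m : Fin K → ℕ) (τ : (ℕ → Fin n → X) → ℕ∞) : ℝ≥0∞ :=
  ⨅ (Ω : ℕ → Fin n → Fin K ⊕ Fin K) (_ : ∀ t, Ω t ∈ labels n m none),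
    ∫⁻ x, (τ x : ℝ≥0∞) ∂(law p Ω)

end

end UnlabeledQCD

/-! The composite problem is compared with a simple one: i.i.d. vectors with law P₀ (the uniform
mixture of unaffected labels) before the change and P₁ (the `β`-weighted mixture) after it. An
expectation under a product measure is affine in every factor. Hence labels can be picked one time
at a time without increasing the mean of τ, so the mean under P₀ is at least WARL (`WARL_le_tsum`).
An integrated delay inequality valid for all label sequences and trajectories likewise survives
mixing (`sum_changeAt_le_WADD`). Any weights `β` may be used; the minimizing ones give the strongest
bound.

For the simple problem let D be the worst delay, I the divergence and M a horizon. With the change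
at index a, let Λ be the log-likelihood ratio accumulated from a until τ or a + M, whichever is
first. On {τ > a}, Wald's identity makes its mean I times the expected number of observations used,
hence at most I(1 + D) P₀(τ > a). The tangent bound Λ ≥ c + 1 - exp(c - Λ) and a change of measure
bound the same mean from below: stopping within the window contributes about c, minus exp(c) times
the P₀-probability of stopping there, and D/M bounds the chance of outlasting the window.

Summed over a, these P₀-probabilities telescope to at most M, while the sum of P₀(τ > a) is at least
γ. Taking exp(c) of order γ/M gives c(1 - D/M) - I(1 + D) ≤ 1 (`delay_bound`), and M ~ (log γ)²
makes D at least (log γ / I)(1 + o(1)). -/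

namespace UnlabeledQCD

/-! ### Infinite products: changing one factor, and cylinder events. -/

section InfiniteProduct

variable {ι E : Type*} [MeasurableSpace E] {μ μ' : ι → Measure E}
  [∀ i, IsProbabilityMeasure (μ i)] [∀ i, IsProbabilityMeasure (μ' i)]

/-- Changing one factor of an infinite product measure amounts to resampling one coordinate. -/
theorem infinitePi_eq_map_update [DecidableEq ι] {t : ι} (h : ∀ i, i ≠ t → μ' i = μ i) :
    Measure.infinitePi μ' =
      ((Measure.infinitePi μ).prod (μ' t)).map fun z => Function.update z.1 t z.2 := by
  have hmeas : Measurable fun z : (ι → E) × E => Function.update z.1 t z.2 :=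
    measurable_update'
  symm
  refine Measure.eq_infinitePi _ fun s u hu => ?_
  rw [Measure.map_apply hmeas (.pi s.countable_toSet fun i _ => hu i)]
  by_cases hts : t ∈ s
  · have hpre : (fun z : (ι → E) × E => Function.update z.1 t z.2) ⁻¹' Set.pi s u =
        (Set.pi ((s.erase t : Finset ι) : Set ι) u) ×ˢ u t := by
      ext z
      simp only [Set.mem_preimage, Set.mem_pi, Finset.mem_coe, Set.mem_prod, Finset.mem_erase]
      constructor
      · intro hz
        refine ⟨fun i hi => ?_, ?_⟩
        · simpa [hi.1] using hz i hi.2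
        · simpa using hz t hts
      · rintro ⟨h1, h2⟩ i hi
        by_cases hit : i = t
        · subst hit; simpa using h2
        · simpa [hit] using h1 i ⟨hit, hi⟩
    rw [hpre, Measure.prod_prod, Measure.infinitePi_pi _ fun i _ => hu i,
      ← Finset.prod_erase_mul _ _ hts]
    congr 1
    exact Finset.prod_congr rfl fun i hi => by rw [h i (Finset.ne_of_mem_erase hi)]
  · have hpre : (fun z : (ι → E) × E => Function.update z.1 t z.2) ⁻¹' Set.pi s u =
        (Set.pi (s : Set ι) u) ×ˢ Set.univ := by
      ext z
      simp only [Set.mem_preimage, Set.mem_pi, Finset.mem_coe, Set.mem_prod, Set.mem_univ,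
        and_true]
      refine forall₂_congr fun i hi => ?_
      rw [Function.update_of_ne (by rintro rfl; exact hts hi)]
    rw [hpre, Measure.prod_prod, Measure.infinitePi_pi _ fun i _ => hu i, measure_univ, mul_one]
    exact Finset.prod_congr rfl fun i hi => by rw [h i (by rintro rfl; exact hts hi)]

theorem lintegral_infinitePi_update [DecidableEq ι] {t : ι} (h : ∀ i, i ≠ t → μ' i = μ i)
    {F : (ι → E) → ℝ≥0∞} (hF : Measurable F) :
    ∫⁻ x, F x ∂Measure.infinitePi μ' =
      ∫⁻ y, ∫⁻ x, F (Function.update x t y) ∂Measure.infinitePi μ ∂μ' t := by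
  rw [infinitePi_eq_map_update h, lintegral_map hF measurable_update']
  exact lintegral_prod_symm' _ (hF.comp measurable_update')

/-- Integrals against an infinite product measure are affine in every factor. -/
theorem lintegral_infinitePi_of_eq_sum [DecidableEq ι] {t : ι} {κ : Type*} [Fintype κ]
    {w : κ → ℝ≥0∞} {ρ : κ → Measure E} [∀ k, IsProbabilityMeasure (ρ k)]
    (h : μ t = ∑ k, w k • ρ k) {F : (ι → E) → ℝ≥0∞} (hF : Measurable F) :
    ∫⁻ x, F x ∂Measure.infinitePi μ =
      ∑ k, w k * ∫⁻ x, F x ∂Measure.infinitePi (Function.update μ t (ρ k)) := by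
  rw [lintegral_infinitePi_update (μ := μ) (fun i _ => rfl) hF, h, lintegral_finsetSum_measure]
  refine Finset.sum_congr rfl fun k _ => ?_
  have : ∀ i, IsProbabilityMeasure (Function.update μ t (ρ k) i) := by
    intro i
    by_cases hi : i = t
    · subst hi; simp only [Function.update_self]; infer_instance
    · simp only [Function.update_of_ne hi]; infer_instance
  rw [lintegral_smul_measure, lintegral_infinitePi_update (μ := μ) (t := t)
    (fun i hi => Function.update_of_ne hi _ _) hF, Function.update_self, smul_eq_mul]

/-- Densities are introduced one factor at a time, because products differing in infinitely many
factors can be mutually singular. -/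
theorem lintegral_infinitePi_of_eq_withDensity [DecidableEq ι] {t : ι}
    (h : ∀ i, i ≠ t → μ' i = μ i) {f : E → ℝ≥0∞} (hf : Measurable f)
    (ht : μ' t = (μ t).withDensity f) {F : (ι → E) → ℝ≥0∞} (hF : Measurable F) :
    ∫⁻ x, F x ∂Measure.infinitePi μ' = ∫⁻ x, f (x t) * F x ∂Measure.infinitePi μ := by
  have hm : Measurable fun y : E =>
      ∫⁻ x, F (Function.update x t y) ∂Measure.infinitePi μ :=
    (hF.comp measurable_update').lintegral_prod_left'
  have hm' : Measurable fun x : ι → E => f (x t) * F x := by fun_prop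
  rw [lintegral_infinitePi_update h hF, ht, lintegral_withDensity_eq_lintegral_mul _ hf hm,
    lintegral_infinitePi_update (μ := μ) (t := t) (fun i _ => rfl) hm']
  refine lintegral_congr fun y => ?_
  simp only [Pi.mul_apply, Function.update_self]
  exact (lintegral_const_mul _ (hF.comp measurable_update_left)).symm

theorem exists_eq_preimage_domRestrict {Δ : Set ι} {G : Set (ι → E)}
    (hG : MeasurableSet[cylinderEvents (X := fun _ => E) Δ] G) :
    ∃ S : Set (Δ → E), MeasurableSet S ∧ Set.domRestrict Δ ⁻¹' S = G := by
  have hle : cylinderEvents (X := fun _ => E) Δ ≤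
      MeasurableSpace.comap (Set.domRestrict (π := fun _ => E) Δ) inferInstance := by
    refine iSup₂_le fun i hi => ?_
    rintro _ ⟨s, hs, rfl⟩
    exact ⟨(fun y : Δ → E => y ⟨i, hi⟩) ⁻¹' s, measurable_pi_apply _ hs, rfl⟩
  exact hle _ hG

theorem infinitePi_congr_cylinderEvents {Δ : Set ι} (h : ∀ i ∈ Δ, μ i = μ' i) {G : Set (ι → E)}
    (hG : MeasurableSet[cylinderEvents (X := fun _ => E) Δ] G) :
    Measure.infinitePi μ G = Measure.infinitePi μ' G := by
  obtain ⟨S, hS, rfl⟩ := exists_eq_preimage_domRestrict hG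
  have hm : Measurable (Set.domRestrict (π := fun _ : ι => E) Δ) :=
    (measurable_restrict_cylinderEvents Δ).mono cylinderEvents_le_pi le_rfl
  rw [← Measure.map_apply hm hS, ← Measure.map_apply hm hS, Measure.infinitePi_map_restrict',
    Measure.infinitePi_map_restrict']
  congr 2
  exact funext fun i => h i i.2

theorem lintegral_infinitePi_congr_cylinderEvents {Δ : Set ι} (h : ∀ i ∈ Δ, μ i = μ' i)
    {F : (ι → E) → ℝ≥0∞} (hF : Measurable[cylinderEvents (X := fun _ => E) Δ] F) :
    ∫⁻ x, F x ∂Measure.infinitePi μ = ∫⁻ x, F x ∂Measure.infinitePi μ' := by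
  have htrim : (Measure.infinitePi μ).trim (cylinderEvents_le_pi (Δ := Δ)) =
      (Measure.infinitePi μ').trim (cylinderEvents_le_pi (Δ := Δ)) := by
    refine @Measure.ext _ (cylinderEvents Δ) _ _ fun s hs => ?_
    rw [trim_measurableSet_eq _ hs, trim_measurableSet_eq _ hs,
      infinitePi_congr_cylinderEvents h hs]
  rw [← lintegral_trim cylinderEvents_le_pi hF, htrim, lintegral_trim cylinderEvents_le_pi hF]

/-- An event that does not involve the coordinate `t` is independent of that coordinate. -/
theorem integral_indicator_eval_infinitePi [DecidableEq ι] {Δ : Set ι} {t : ι} (ht : t ∉ Δ)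
    {G : Set (ι → E)} (hG : MeasurableSet[cylinderEvents (X := fun _ => E) Δ] G)
    {f : E → ℝ} (hf : Measurable f) :
    ∫ x, G.indicator (fun x => f (x t)) x ∂Measure.infinitePi μ =
      (Measure.infinitePi μ).real G * ∫ y, f y ∂μ t := by
  obtain ⟨S, hS, hSG⟩ := exists_eq_preimage_domRestrict hG
  have hGm : MeasurableSet G := cylinderEvents_le_pi _ hG
  have hupd : ∀ (x : ι → E) y, Function.update x t y ∈ G ↔ x ∈ G := by
    intro x y
    rw [← hSG, Set.mem_preimage, Set.mem_preimage]
    convert! Iff.rfl using 2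
    ext i
    have : (i : ι) ≠ t := fun h => ht (h ▸ i.2)
    simp [Set.domRestrict, this]
  have hm : Measurable (G.indicator fun x : ι → E => f (x t)) :=
    (hf.comp (measurable_pi_apply t)).indicator hGm
  -- Resampling coordinate `t` from its own law changes nothing, but turns the integrand into a
  -- product over independent variables.
  conv_lhs => rw [infinitePi_eq_map_update (μ := μ) (μ' := μ) (t := t) fun i _ => rfl]
  rw [integral_map measurable_update'.aemeasurable hm.aestronglyMeasurable]
  have : (fun z : (ι → E) × E => G.indicator (fun x => f (x t)) (Function.update z.1 t z.2)) =
      fun z => G.indicator (fun _ => (1 : ℝ)) z.1 * f z.2 := by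
    ext z
    by_cases hz : z.1 ∈ G
    · simp [hz, hupd]
    · simp [hz, hupd]
  rw [this, integral_prod_mul, integral_indicator hGm]
  simp

end InfiniteProduct

/-! ### Likelihood ratios over a finite window. -/

noncomputable section ChangeOfMeasure

variable {E : Type*} [MeasurableSpace E] {P₀ P₁ : Measure E}

/-- The factor at time `t` is `P₀` before time `a` and `P₁` from then on. -/
def changeAt (P₀ P₁ : Measure E) (a t : ℕ) : Measure E := if t < a then P₀ else P₁

/-- The factor at time `t` is `P₁` for `a ≤ t < a + i` and `P₀` otherwise. -/
def changeWindow (P₀ P₁ : Measure E) (a i t : ℕ) : Measure E :=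
  if a ≤ t ∧ t < a + i then P₁ else P₀

instance [IsProbabilityMeasure P₀] [IsProbabilityMeasure P₁] (a t : ℕ) :
    IsProbabilityMeasure (changeAt P₀ P₁ a t) := by
  unfold changeAt; split_ifs <;> infer_instance

instance [IsProbabilityMeasure P₀] [IsProbabilityMeasure P₁] (a i t : ℕ) :
    IsProbabilityMeasure (changeWindow P₀ P₁ a i t) := by
  unfold changeWindow; split_ifs <;> infer_instance

/-- The log-likelihood ratio of the `i` observations from time `a` on. -/
def cumLLR (P₀ P₁ : Measure E) (a i : ℕ) (x : ℕ → E) : ℝ :=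
  ∑ j ∈ Finset.range i, llr P₁ P₀ (x (a + j))

theorem cumLLR_succ (a i : ℕ) (x : ℕ → E) :
    cumLLR P₀ P₁ a (i + 1) x = cumLLR P₀ P₁ a i x + llr P₁ P₀ (x (a + i)) :=
  Finset.sum_range_succ _ _

theorem measurable_cumLLR_cylinderEvents (a i : ℕ) :
    Measurable[cylinderEvents (X := fun _ => E) (Set.Iio (a + i))] (cumLLR P₀ P₁ a i) := by
  refine Finset.measurable_fun_sum _ fun j hj => ?_
  refine (measurable_llr P₁ P₀).comp (measurable_cylinderEvent_apply ?_)
  simpa using hj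

theorem measurable_cumLLR (a i : ℕ) : Measurable (cumLLR P₀ P₁ a i) :=
  (measurable_cumLLR_cylinderEvents a i).mono cylinderEvents_le_pi le_rfl

/-- The product is 1 where the density is positive. Where it vanishes, `Real.log 0 = 0` makes the
exponential 1 and the product 0, hence only an inequality. -/
theorem rnDeriv_mul_exp_neg_llr_le_one {y : E} (hy : P₁.rnDeriv P₀ y ≠ ∞) :
    P₁.rnDeriv P₀ y * ENNReal.ofReal (Real.exp (-llr P₁ P₀ y)) ≤ 1 := by
  by_cases h0 : P₁.rnDeriv P₀ y = 0
  · simp [h0]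
  · rw [llr, Real.exp_neg, Real.exp_log (ENNReal.toReal_pos h0 hy),
      ENNReal.ofReal_inv_of_pos (ENNReal.toReal_pos h0 hy), ENNReal.ofReal_toReal hy,
      ENNReal.mul_inv_cancel h0 hy]

variable [IsProbabilityMeasure P₀] [IsProbabilityMeasure P₁]

theorem lintegral_changeWindow (hac : P₁ ≪ P₀) (a i : ℕ) {F : (ℕ → E) → ℝ≥0∞}
    (hF : Measurable F) :
    ∫⁻ x, F x ∂Measure.infinitePi (changeWindow P₀ P₁ a i) =
      ∫⁻ x, (∏ j ∈ Finset.range i, P₁.rnDeriv P₀ (x (a + j))) * F x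
        ∂Measure.infinitePi fun _ : ℕ => P₀ := by
  induction i generalizing F with
  | zero =>
    have : changeWindow P₀ P₁ a 0 = fun _ => P₀ := by
      ext1 t; simp [changeWindow]
    simp [this]
  | succ i ih =>
    have hf := Measure.measurable_rnDeriv P₁ P₀
    rw [lintegral_infinitePi_of_eq_withDensity (μ := changeWindow P₀ P₁ a i) (t := a + i)
      (f := P₁.rnDeriv P₀) _ hf _ hF, ih (by fun_prop)]
    · refine lintegral_congr fun x => ?_
      rw [Finset.prod_range_succ, mul_assoc]
    · intro t ht
      unfold changeWindow
      congr 1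
      apply propext
      omega
    · simp [changeWindow, Measure.withDensity_rnDeriv_eq _ _ hac]

/-- The integrand sees only coordinates before `a + i`, where a permanent change and a change
confined to the window agree. The latter has a density with respect to the pre-change law, which the
exponential cancels. -/
theorem setLIntegral_exp_neg_cumLLR_le (hac : P₁ ≪ P₀) (a i : ℕ) {G : Set (ℕ → E)}
    (hG : MeasurableSet[cylinderEvents (X := fun _ => E) (Set.Iio (a + i))] G) :
    ∫⁻ x in G, ENNReal.ofReal (Real.exp (-cumLLR P₀ P₁ a i x))
        ∂Measure.infinitePi (changeAt P₀ P₁ a) ≤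
      Measure.infinitePi (fun _ : ℕ => P₀) G := by
  have hGm : MeasurableSet G := cylinderEvents_le_pi _ hG
  have hΛ : Measurable[cylinderEvents (X := fun _ => E) (Set.Iio (a + i))]
      fun x => ENNReal.ofReal (Real.exp (-cumLLR P₀ P₁ a i x)) :=
    (measurable_cumLLR_cylinderEvents a i).neg.exp.ennreal_ofReal
  have hΛG := hΛ.indicator hG
  rw [← lintegral_indicator hGm, lintegral_infinitePi_congr_cylinderEvents
    (μ' := changeWindow P₀ P₁ a i) (Δ := Set.Iio (a + i)) _ hΛG,
    lintegral_changeWindow hac _ _ (hΛG.mono cylinderEvents_le_pi le_rfl),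
    ← lintegral_indicator_one hGm]
  · refine lintegral_mono_ae ?_
    have hfin : ∀ᵐ x ∂Measure.infinitePi (fun _ : ℕ => P₀),
        ∀ j, P₁.rnDeriv P₀ (x (a + j)) < ∞ := by
      refine ae_all_iff.2 fun j => ?_
      exact (measurePreserving_eval_infinitePi (fun _ : ℕ => P₀)
        (a + j)).quasiMeasurePreserving.ae (Measure.rnDeriv_lt_top P₁ P₀)
    filter_upwards [hfin] with x hx
    by_cases hxG : x ∈ G
    · rw [Set.indicator_of_mem hxG, Set.indicator_of_mem hxG, cumLLR, ← Finset.sum_neg_distrib,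
        Real.exp_sum, ENNReal.ofReal_prod_of_nonneg fun _ _ => (Real.exp_pos _).le,
        ← Finset.prod_mul_distrib]
      exact Finset.prod_le_one' fun j _ => rnDeriv_mul_exp_neg_llr_le_one (hx j).ne
    · simp [hxG]
  · intro t ht
    simp only [Set.mem_Iio] at ht
    unfold changeAt changeWindow
    by_cases h : t < a
    · simp [h, h.not_ge]
    · simp [h, ht, not_lt.1 h]

theorem integrable_llr_eval (hint : Integrable (llr P₁ P₀) P₁) {a t : ℕ} (h : a ≤ t) :
    Integrable (fun x => llr P₁ P₀ (x t)) (Measure.infinitePi (changeAt P₀ P₁ a)) := by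
  have hmp := measurePreserving_eval_infinitePi (changeAt P₀ P₁ a) t
  have : changeAt P₀ P₁ a t = P₁ := by simp [changeAt, h.not_gt]
  rw [this] at hmp
  exact hmp.integrable_comp_of_integrable hint

theorem integrable_cumLLR (hint : Integrable (llr P₁ P₀) P₁) (a i : ℕ) :
    Integrable (cumLLR P₀ P₁ a i) (Measure.infinitePi (changeAt P₀ P₁ a)) :=
  integrable_finsetSum _ fun _ _ => integrable_llr_eval hint (Nat.le_add_right _ _)

/-- A lower bound for the mean log-likelihood ratio on an event in terms of the probabilities of
that event before and after the change. -/
theorem le_setIntegral_cumLLR (hac : P₁ ≪ P₀) (hint : Integrable (llr P₁ P₀) P₁) (a i : ℕ)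
    {G : Set (ℕ → E)}
    (hG : MeasurableSet[cylinderEvents (X := fun _ => E) (Set.Iio (a + i))] G) (c : ℝ) :
    (c + 1) * (Measure.infinitePi (changeAt P₀ P₁ a)).real G
        - Real.exp c * (Measure.infinitePi fun _ : ℕ => P₀).real G ≤
      ∫ x in G, cumLLR P₀ P₁ a i x ∂Measure.infinitePi (changeAt P₀ P₁ a) := by
  set Q := Measure.infinitePi (changeAt P₀ P₁ a)
  have hle := setLIntegral_exp_neg_cumLLR_le hac a i hG
  have hm : Measurable fun x => Real.exp (-cumLLR P₀ P₁ a i x) := (measurable_cumLLR a i).neg.exp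
  have hpos : ∀ x, 0 ≤ Real.exp (-cumLLR P₀ P₁ a i x) := fun x => (Real.exp_pos _).le
  have hi : IntegrableOn (fun x => Real.exp (-cumLLR P₀ P₁ a i x)) G Q :=
    (lintegral_ofReal_ne_top_iff_integrable hm.aestronglyMeasurable (ae_of_all _ hpos)).1
      (hle.trans_lt (measure_lt_top _ _)).ne
  have hexp : ∫ x in G, Real.exp (-cumLLR P₀ P₁ a i x) ∂Q ≤
      (Measure.infinitePi fun _ : ℕ => P₀).real G := by
    rw [integral_eq_lintegral_of_nonneg_ae (ae_of_all _ hpos) hm.aestronglyMeasurable]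
    exact ENNReal.toReal_mono (measure_ne_top _ _) hle
  calc (c + 1) * Q.real G - Real.exp c * (Measure.infinitePi fun _ : ℕ => P₀).real G
      ≤ (c + 1) * Q.real G - Real.exp c * ∫ x in G, Real.exp (-cumLLR P₀ P₁ a i x) ∂Q := by
        gcongr
    _ = ∫ x in G, (c + 1 - Real.exp c * Real.exp (-cumLLR P₀ P₁ a i x)) ∂Q := by
        rw [integral_sub (integrable_const _) (hi.const_mul _), integral_const_mul,
          setIntegral_const, smul_eq_mul, mul_comm]
    _ ≤ ∫ x in G, cumLLR P₀ P₁ a i x ∂Q := by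
        refine integral_mono ((integrable_const _).sub (hi.const_mul _))
          (integrable_cumLLR hint a i).integrableOn fun x => ?_
        -- The tangent to the exponential at 0, evaluated at `c - Λ`.
        have := Real.add_one_le_exp (c + -cumLLR P₀ P₁ a i x)
        rw [Real.exp_add] at this
        simp only
        linarith

end ChangeOfMeasure

/-! ### The delay bound for a simple change from P₀ to P₁. -/

noncomputable section DelayBound

variable {E : Type*} [MeasurableSpace E] {P₀ P₁ : Measure E} [IsProbabilityMeasure P₀]
  [IsProbabilityMeasure P₁] {A : ℕ → Set (ℕ → E)}

/-- A form of Wald's identity combined with the change of measure. The set `A a` stands for the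
event that a stopping time exceeds `a`. -/
theorem le_integral_llr_mul_sum (hac : P₁ ≪ P₀) (hint : Integrable (llr P₁ P₀) P₁)
    (hA : ∀ a, MeasurableSet[cylinderEvents (X := fun _ => E) (Set.Iio a)] (A a))
    (hanti : Antitone A) (a i : ℕ) (c : ℝ) :
    (c + 1) * ((Measure.infinitePi (changeAt P₀ P₁ a)).real (A a)
        - (Measure.infinitePi (changeAt P₀ P₁ a)).real (A (a + i)))
      - Real.exp c * ((Measure.infinitePi fun _ : ℕ => P₀).real (A a)
        - (Measure.infinitePi fun _ : ℕ => P₀).real (A (a + i)))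
      + ∫ x in A (a + i), cumLLR P₀ P₁ a i x ∂Measure.infinitePi (changeAt P₀ P₁ a) ≤
    (∫ y, llr P₁ P₀ y ∂P₁) * ∑ j ∈ Finset.range i,
      (Measure.infinitePi (changeAt P₀ P₁ a)).real (A (a + j)) := by
  set Q := Measure.infinitePi (changeAt P₀ P₁ a)
  set P := Measure.infinitePi fun _ : ℕ => P₀
  have hAm : ∀ b, MeasurableSet (A b) := fun b => cylinderEvents_le_pi _ (hA b)
  induction i with
  | zero => simp [cumLLR]
  | succ i ih =>
    rw [Finset.sum_range_succ, mul_add]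
    -- Surviving past `a + i` is decided by the coordinates below `a + i`, so it is independent of
    -- the next increment.
    have hwald : ∫ x in A (a + i), llr P₁ P₀ (x (a + i)) ∂Q =
        Q.real (A (a + i)) * ∫ y, llr P₁ P₀ y ∂P₁ := by
      rw [← integral_indicator (hAm _)]
      have := integral_indicator_eval_infinitePi (μ := changeAt P₀ P₁ a) (Δ := Set.Iio (a + i))
        (t := a + i) (by simp) (hA (a + i)) (measurable_llr P₁ P₀)
      rw [this, show changeAt P₀ P₁ a (a + i) = P₁ by simp [changeAt]]
    have hsucc : ∫ x in A (a + i), cumLLR P₀ P₁ a (i + 1) x ∂Q =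
        ∫ x in A (a + i), cumLLR P₀ P₁ a i x ∂Q +
          Q.real (A (a + i)) * ∫ y, llr P₁ P₀ y ∂P₁ := by
      simp_rw [cumLLR_succ]
      rw [integral_add (integrable_cumLLR hint a i).integrableOn
        (integrable_llr_eval hint (Nat.le_add_right _ _)).integrableOn, hwald]
    have hsub : A (a + (i + 1)) ⊆ A (a + i) := hanti (by omega)
    have hdiff : ∫ x in A (a + i), cumLLR P₀ P₁ a (i + 1) x ∂Q =
        ∫ x in A (a + i) \ A (a + (i + 1)), cumLLR P₀ P₁ a (i + 1) x ∂Q +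
          ∫ x in A (a + (i + 1)), cumLLR P₀ P₁ a (i + 1) x ∂Q := by
      rw [← setIntegral_union Set.disjoint_sdiff_left (hAm _)
        (integrable_cumLLR hint a (i + 1)).integrableOn
        (integrable_cumLLR hint a (i + 1)).integrableOn, Set.sdiff_union_of_subset hsub]
    have hexit := le_setIntegral_cumLLR hac hint a (i + 1)
      (G := A (a + i) \ A (a + (i + 1)))
      (MeasurableSet.diff (cylinderEvents_mono (Set.Iio_subset_Iio (by omega)) _ (hA (a + i)))
        (hA (a + (i + 1)))) c
    rw [measureReal_sdiff hsub (hAm _), measureReal_sdiff hsub (hAm _)] at hexit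
    linarith

theorem measureReal_changeAt_eq
    (hA : ∀ a, MeasurableSet[cylinderEvents (X := fun _ => E) (Set.Iio a)] (A a)) (a : ℕ) :
    (Measure.infinitePi (changeAt P₀ P₁ a)).real (A a) =
      (Measure.infinitePi fun _ : ℕ => P₀).real (A a) := by
  rw [measureReal_def, measureReal_def,
    infinitePi_congr_cylinderEvents (μ := changeAt P₀ P₁ a) (μ' := fun _ => P₀) _ (hA a)]
  intro t ht
  simp [changeAt, Set.mem_Iio.1 ht]

theorem delay_bound_at (hac : P₁ ≪ P₀) (hint : Integrable (llr P₁ P₀) P₁)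
    (hI : 0 ≤ ∫ y, llr P₁ P₀ y ∂P₁)
    (hA : ∀ a, MeasurableSet[cylinderEvents (X := fun _ => E) (Set.Iio a)] (A a))
    (hanti : Antitone A) {D : ℝ} (a : ℕ) {M : ℕ} (hM : 0 < M)
    (hD : ∑ j ∈ Finset.range M,
        (Measure.infinitePi (changeAt P₀ P₁ a)).real (A (a + (j + 1))) ≤
      D * (Measure.infinitePi (changeAt P₀ P₁ a)).real (A a)) {c : ℝ} (hc : 0 ≤ c) :
    (c * (1 - D / M) - (∫ y, llr P₁ P₀ y ∂P₁) * (1 + D)) *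
        (Measure.infinitePi fun _ : ℕ => P₀).real (A a) ≤
      Real.exp c * ((Measure.infinitePi fun _ : ℕ => P₀).real (A a)
        - (Measure.infinitePi fun _ : ℕ => P₀).real (A (a + M))) := by
  have hmain := le_integral_llr_mul_sum hac hint hA hanti a M c
  -- On paths outlasting the window level 0 suffices: its term `Q.real (A (a + M))` cancels the one
  -- lost from the `+ 1` in `c + 1`.
  have hlast := le_setIntegral_cumLLR hac hint a M (hA (a + M)) 0
  rw [measureReal_changeAt_eq hA] at hmain hD
  set Q := Measure.infinitePi (changeAt P₀ P₁ a)
  set P := Measure.infinitePi fun _ : ℕ => P₀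
  set I := ∫ y, llr P₁ P₀ y ∂P₁
  -- Markov's inequality: each of the `M` summands is at least the last one.
  have hMq : M * Q.real (A (a + M)) ≤ D * P.real (A a) := by
    refine le_trans ?_ hD
    rw [← nsmul_eq_mul, ← Finset.card_range M, ← Finset.sum_const, Finset.card_range]
    exact Finset.sum_le_sum fun j hj => measureReal_mono (hanti (by
      have := Finset.mem_range.1 hj; omega))
  have hsum : ∑ j ∈ Finset.range M, Q.real (A (a + j)) ≤ (1 + D) * P.real (A a) := by
    calc ∑ j ∈ Finset.range M, Q.real (A (a + j))
        ≤ ∑ j ∈ Finset.range (M + 1), Q.real (A (a + j)) :=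
          Finset.sum_le_sum_of_subset_of_nonneg (Finset.range_subset_range.2 (Nat.le_succ M))
            fun _ _ _ => measureReal_nonneg
      _ ≤ _ := by
          rw [Finset.sum_range_succ']
          have : Q.real (A (a + 0)) = P.real (A a) := measureReal_changeAt_eq hA a
          rw [this]
          linarith
  have hM' : (0 : ℝ) < M := Nat.cast_pos.2 hM
  have hq : Q.real (A (a + M)) ≤ D / M * P.real (A a) := by
    rw [div_mul_eq_mul_div, le_div_iff₀ hM']
    linarith
  have hb : P.real (A (a + M)) ≤ P.real (A a) := measureReal_mono (hanti (by omega))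
  have h1 := mul_le_mul_of_nonneg_left hsum hI
  have h2 := mul_le_mul_of_nonneg_left hq hc
  simp only [Real.exp_zero] at hlast
  linarith

/-- Summing the delay bound over the change points. -/
theorem delay_bound_sum (hac : P₁ ≪ P₀) (hint : Integrable (llr P₁ P₀) P₁)
    (hI : 0 ≤ ∫ y, llr P₁ P₀ y ∂P₁)
    (hA : ∀ a, MeasurableSet[cylinderEvents (X := fun _ => E) (Set.Iio a)] (A a))
    (hanti : Antitone A) {D : ℝ} {M : ℕ} (hM : 0 < M)
    (hD : ∀ a, ∑ j ∈ Finset.range M,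
        (Measure.infinitePi (changeAt P₀ P₁ a)).real (A (a + (j + 1))) ≤
      D * (Measure.infinitePi (changeAt P₀ P₁ a)).real (A a)) {c : ℝ} (hc : 0 ≤ c) (T : ℕ) :
    (c * (1 - D / M) - (∫ y, llr P₁ P₀ y ∂P₁) * (1 + D)) *
        ∑ a ∈ Finset.range T, (Measure.infinitePi fun _ : ℕ => P₀).real (A a) ≤
      Real.exp c * M := by
  have hsum := Finset.sum_le_sum fun a (_ : a ∈ Finset.range T) =>
    delay_bound_at hac hint hI hA hanti a hM (hD a) hc
  rw [← Finset.mul_sum, ← Finset.mul_sum, Finset.sum_sub_distrib] at hsum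
  refine hsum.trans (mul_le_mul_of_nonneg_left ?_ (Real.exp_pos c).le)
  set b := fun a => (Measure.infinitePi fun _ : ℕ => P₀).real (A a)
  -- Subtracting the sum shifted by `M` leaves at most the first `M` terms, each at most 1.
  have h1 : ∑ a ∈ Finset.range T, b a ≤ ∑ a ∈ Finset.range (M + T), b a :=
    Finset.sum_le_sum_of_subset_of_nonneg (Finset.range_subset_range.2 (Nat.le_add_left _ _))
      fun _ _ _ => measureReal_nonneg
  rw [Finset.sum_range_add] at h1
  have h2 : ∑ a ∈ Finset.range M, b a ≤ M := by
    refine (Finset.sum_le_card_nsmul _ _ 1 fun a _ => measureReal_le_one).trans ?_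
    simp
  have h3 : ∑ a ∈ Finset.range T, b (M + a) = ∑ a ∈ Finset.range T, b (a + M) :=
    Finset.sum_congr rfl fun a _ => by rw [add_comm]
  change ∑ a ∈ Finset.range T, b a - ∑ a ∈ Finset.range T, b (a + M) ≤ M
  linarith

/-- A non-asymptotic lower bound `D` on the worst-case delay of a stopping time whose mean under the
pre-change law is at least `γ`. -/
theorem delay_bound (hac : P₁ ≪ P₀) (hint : Integrable (llr P₁ P₀) P₁)
    (hI : 0 ≤ ∫ y, llr P₁ P₀ y ∂P₁)
    (hA : ∀ a, MeasurableSet[cylinderEvents (X := fun _ => E) (Set.Iio a)] (A a))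
    (hanti : Antitone A) {D : ℝ} {M : ℕ} (hM : 0 < M)
    (hD : ∀ a, ∑ j ∈ Finset.range M,
        (Measure.infinitePi (changeAt P₀ P₁ a)).real (A (a + (j + 1))) ≤
      D * (Measure.infinitePi (changeAt P₀ P₁ a)).real (A a))
    {γ : ℝ} (hγM : 2 * M ≤ γ)
    (hγ : ENNReal.ofReal γ ≤ ∑' a, Measure.infinitePi (fun _ : ℕ => P₀) (A a)) :
    Real.log (γ / (2 * M)) * (1 - D / M) - (∫ y, llr P₁ P₀ y ∂P₁) * (1 + D) ≤ 1 := by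
  have hM' : (0 : ℝ) < M := Nat.cast_pos.2 hM
  have hγ0 : 0 < γ := by linarith
  obtain ⟨T, hT⟩ : ∃ T, γ / 2 ≤
      ∑ a ∈ Finset.range T, (Measure.infinitePi fun _ : ℕ => P₀).real (A a) := by
    have hlt : ENNReal.ofReal (γ / 2) < ∑' a, Measure.infinitePi (fun _ : ℕ => P₀) (A a) :=
      lt_of_lt_of_le ((ENNReal.ofReal_lt_ofReal_iff hγ0).2 (by linarith)) hγ
    rw [ENNReal.tsum_eq_iSup_nat, lt_iSup_iff] at hlt
    obtain ⟨T, hT⟩ := hlt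
    refine ⟨T, ?_⟩
    have := (ENNReal.ofReal_le_iff_le_toReal
      (ENNReal.sum_ne_top.2 fun a _ => measure_ne_top _ _)).1 hT.le
    rwa [ENNReal.toReal_sum fun a _ => measure_ne_top _ _] at this
  have h1 : 1 ≤ γ / (2 * M) := (one_le_div (by positivity)).2 hγM
  -- The level is chosen so that `exp c * M = γ / 2`, matching the lower bound on the partial sum.
  have hsum := delay_bound_sum hac hint hI hA hanti hM hD (Real.log_nonneg h1) T
  rw [Real.exp_log (by positivity), show γ / (2 * M) * M = γ / 2 by field_simp] at hsum
  by_contra! hcon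
  have := mul_lt_mul_of_pos_right hcon (show 0 < γ / 2 by positivity)
  have := mul_le_mul_of_nonneg_left hT (zero_le_one.trans hcon.le)
  linarith

end DelayBound

/-! ### Passing between mixtures and their components. -/

noncomputable section Mixtures

variable {E : Type*} [MeasurableSpace E]

/-- `ρ` is a finite convex combination of probability measures in `C`. -/
def IsMixture (C : Set (Measure E)) (ρ : Measure E) : Prop :=
  ∃ (κ : Type) (_ : Fintype κ) (w : κ → ℝ≥0∞) (σ : κ → Measure E),
    (∀ k, IsProbabilityMeasure (σ k)) ∧ (∀ k, w k ≠ 0 → σ k ∈ C) ∧ ∑ k, w k = 1 ∧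
      ρ = ∑ k, w k • σ k

theorem IsMixture.isProbabilityMeasure {C : Set (Measure E)} {ρ : Measure E}
    (h : IsMixture C ρ) : IsProbabilityMeasure ρ := by
  obtain ⟨κ, _, w, σ, hσ, -, hw, rfl⟩ := h
  refine ⟨?_⟩
  simp [Measure.finsetSum_apply, hw]

theorem IsMixture.nonempty {C : Set (Measure E)} {ρ : Measure E} (h : IsMixture C ρ) :
    C.Nonempty := by
  obtain ⟨κ, _, w, σ, -, hC, hw, -⟩ := h
  obtain ⟨k, -, hk⟩ := Finset.exists_ne_zero_of_sum_ne_zero (hw.trans_ne one_ne_zero)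
  exact ⟨σ k, hC k hk⟩

theorem isProbabilityMeasure_update {μ : ℕ → Measure E} (hμ : ∀ t, IsProbabilityMeasure (μ t))
    (t : ℕ) {ρ : Measure E} (hρ : IsProbabilityMeasure ρ) (i : ℕ) :
    IsProbabilityMeasure (Function.update μ t ρ i) := by
  by_cases hi : i = t
  · subst hi; simpa using hρ
  · simpa [hi] using hμ i

theorem IsMixture.lintegral_le_of_forall {C : Set (Measure E)} {μ : ℕ → Measure E}
    (hμ : ∀ t, IsProbabilityMeasure (μ t)) {t : ℕ} (ht : IsMixture C (μ t))
    {F G : (ℕ → E) → ℝ≥0∞} (hF : Measurable F) (hG : Measurable G)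
    (h : ∀ ρ ∈ C, ∫⁻ x, F x ∂Measure.infinitePi (Function.update μ t ρ) ≤
      ∫⁻ x, G x ∂Measure.infinitePi (Function.update μ t ρ)) :
    ∫⁻ x, F x ∂Measure.infinitePi μ ≤ ∫⁻ x, G x ∂Measure.infinitePi μ := by
  obtain ⟨κ, _, w, σ, hσ, hC, -, hsum⟩ := ht
  rw [lintegral_infinitePi_of_eq_sum hsum hF, lintegral_infinitePi_of_eq_sum hsum hG]
  refine Finset.sum_le_sum fun k _ => ?_
  by_cases hk : w k = 0
  · simp [hk]
  · exact mul_le_mul_right (h _ (hC k hk)) _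

/-- Some component of positive weight does not exceed the weighted average. -/
theorem IsMixture.exists_lintegral_le {C : Set (Measure E)} {μ : ℕ → Measure E}
    (hμ : ∀ t, IsProbabilityMeasure (μ t)) {t : ℕ} (ht : IsMixture C (μ t))
    {F : (ℕ → E) → ℝ≥0∞} (hF : Measurable F) :
    ∃ ρ ∈ C, IsProbabilityMeasure ρ ∧
      ∫⁻ x, F x ∂Measure.infinitePi (Function.update μ t ρ) ≤
        ∫⁻ x, F x ∂Measure.infinitePi μ := by
  obtain ⟨κ, _, w, σ, hσ, hC, hw, hsum⟩ := ht
  set e := ∫⁻ x, F x ∂Measure.infinitePi μ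
  have he : ∑ k, w k * ∫⁻ x, F x ∂Measure.infinitePi (Function.update μ t (σ k)) = e :=
    (lintegral_infinitePi_of_eq_sum hsum hF).symm
  by_contra! hcon
  have hlt : ∀ k, w k ≠ 0 →
      e < ∫⁻ x, F x ∂Measure.infinitePi (Function.update μ t (σ k)) :=
    fun k hk => hcon _ (hC k hk) (hσ k)
  obtain ⟨k₀, -, hk₀⟩ := Finset.exists_ne_zero_of_sum_ne_zero (hw.trans_ne one_ne_zero)
  have hetop : e ≠ ∞ := (hlt k₀ hk₀).ne_top
  have hwtop : ∀ k, w k ≠ ∞ := fun k =>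
    ne_top_of_le_ne_top ENNReal.one_ne_top
      (hw ▸ Finset.single_le_sum (fun _ _ => zero_le) (Finset.mem_univ k))
  have : ∑ k, w k * e <
      ∑ k, w k * ∫⁻ x, F x ∂Measure.infinitePi (Function.update μ t (σ k)) := by
    classical
    rw [← Finset.sum_erase_add _ _ (Finset.mem_univ k₀),
      ← Finset.sum_erase_add _ _ (Finset.mem_univ k₀)]
    refine ENNReal.add_lt_add_of_le_of_lt
      (ENNReal.sum_ne_top.2 fun k _ => ENNReal.mul_ne_top (hwtop k) hetop)
      (Finset.sum_le_sum fun k _ => ?_) (by gcongr; exacts [hwtop k₀, hlt k₀ hk₀])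
    by_cases hk : w k = 0
    · simp [hk]
    · exact mul_le_mul_right (hlt k hk).le _
  rw [he, ← Finset.sum_mul, hw, one_mul] at this
  exact this.false

/-- An inequality between integrals of functions of finitely many coordinates passes from product
measures to product measures of mixtures. -/
theorem lintegral_le_of_forall_isMixture {C : ℕ → Set (Measure E)}
    (hC : ∀ t, ∀ ρ ∈ C t, IsProbabilityMeasure ρ) {μ : ℕ → Measure E}
    (hμ : ∀ t, IsMixture (C t) (μ t)) {T : ℕ} {F G : (ℕ → E) → ℝ≥0∞}
    (hF : Measurable[cylinderEvents (X := fun _ => E) (Set.Iio T)] F)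
    (hG : Measurable[cylinderEvents (X := fun _ => E) (Set.Iio T)] G)
    (h : ∀ μ' : ℕ → Measure E, (∀ t, μ' t ∈ C t) →
      ∫⁻ x, F x ∂Measure.infinitePi μ' ≤ ∫⁻ x, G x ∂Measure.infinitePi μ') :
    ∫⁻ x, F x ∂Measure.infinitePi μ ≤ ∫⁻ x, G x ∂Measure.infinitePi μ := by
  have hF' := hF.mono cylinderEvents_le_pi le_rfl
  have hG' := hG.mono cylinderEvents_le_pi le_rfl
  -- Induction on the number of leading coordinates that are still mixtures. Only those below `T`
  -- matter, so finitely many replacements suffice.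
  have key : ∀ S : ℕ, ∀ μ' : ℕ → Measure E, (∀ t < S, IsMixture (C t) (μ' t)) →
      (∀ t, S ≤ t → μ' t ∈ C t) →
      ∫⁻ x, F x ∂Measure.infinitePi μ' ≤ ∫⁻ x, G x ∂Measure.infinitePi μ' := by
    intro S
    induction S with
    | zero => exact fun μ' _ h2 => h μ' fun t => h2 t (Nat.zero_le t)
    | succ S ih =>
      intro μ' h1 h2
      have hprob : ∀ t, IsProbabilityMeasure (μ' t) := fun t => by
        by_cases ht : t < S + 1
        · exact (h1 t ht).isProbabilityMeasure
        · exact hC t _ (h2 t (not_lt.1 ht))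
      refine (h1 S (Nat.lt_succ_self S)).lintegral_le_of_forall hprob hF' hG' fun ρ hρ => ?_
      refine ih _ (fun t ht => ?_) fun t ht => ?_
      · rw [Function.update_of_ne ht.ne]
        exact h1 t (by omega)
      · obtain rfl | hne := eq_or_ne t S
        · simpa using hρ
        · rw [Function.update_of_ne hne]
          exact h2 t (by omega)
  choose ρ hρ using fun t => (hμ t).nonempty
  set μ' : ℕ → Measure E := fun t => if t < T then μ t else ρ t
  have hprob : ∀ t, IsProbabilityMeasure (μ t) := fun t => (hμ t).isProbabilityMeasure
  have hprob' : ∀ t, IsProbabilityMeasure (μ' t) := fun t => by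
    by_cases ht : t < T
    · simpa [μ', ht] using hprob t
    · simpa [μ', ht] using hC t _ (hρ t)
  have hagree : ∀ t ∈ Set.Iio T, μ t = μ' t := fun t ht => by
    simp [μ', Set.mem_Iio.1 ht]
  rw [lintegral_infinitePi_congr_cylinderEvents hagree hF,
    lintegral_infinitePi_congr_cylinderEvents hagree hG]
  refine key T μ' (fun t ht => ?_) fun t ht => ?_
  · simpa [μ', ht] using hμ t
  · simpa [μ', ht.not_gt] using hρ t

/-- Choosing the components of the mixtures one coordinate after the other does not increase the
mean of a stopping time; `A a` stands for the event that it exceeds `a`. -/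
theorem exists_tsum_infinitePi_le {C : ℕ → Set (Measure E)} {μ : ℕ → Measure E}
    (hμ : ∀ t, IsMixture (C t) (μ t)) {A : ℕ → Set (ℕ → E)}
    (hA : ∀ a, MeasurableSet[cylinderEvents (X := fun _ => E) (Set.Iio a)] (A a)) :
    ∃ μ' : ℕ → Measure E, (∀ t, μ' t ∈ C t) ∧
      ∑' a, Measure.infinitePi μ' (A a) ≤ ∑' a, Measure.infinitePi μ (A a) := by
  have hAm : ∀ a, MeasurableSet (A a) := fun a => cylinderEvents_le_pi _ (hA a)
  set F : (ℕ → E) → ℝ≥0∞ := fun x => ∑' a, (A a).indicator 1 x with hFdef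
  have hF : Measurable F := Measurable.tsum fun a => measurable_one.indicator (hAm a)
  have hFint : ∀ ρ : Measure (ℕ → E), ∫⁻ x, F x ∂ρ = ∑' a, ρ (A a) := fun ρ => by
    rw [hFdef, lintegral_tsum fun a => (measurable_one.indicator (hAm a)).aemeasurable]
    exact tsum_congr fun a => lintegral_indicator_one (hAm a)
  simp_rw [← hFint]
  set e := ∫⁻ x, F x ∂Measure.infinitePi μ
  -- Stage `T`: the first `T` factors are chosen components, the others are still mixtures, and the
  -- mean has not grown.
  let Good : ℕ → (ℕ → Measure E) → Prop := fun T κ =>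
    (∀ t, IsProbabilityMeasure (κ t)) ∧ (∀ t < T, κ t ∈ C t) ∧ (∀ t, T ≤ t → κ t = μ t) ∧
      ∫⁻ x, F x ∂Measure.infinitePi κ ≤ e
  have step : ∀ T κ, Good T κ → ∃ ρ, Good (T + 1) (Function.update κ T ρ) := by
    rintro T κ ⟨h1, h2, h3, h4⟩
    obtain ⟨ρ, hρC, hρ, hle⟩ :=
      IsMixture.exists_lintegral_le h1 ((h3 T le_rfl).symm ▸ hμ T) hF
    refine ⟨ρ, isProbabilityMeasure_update h1 T hρ, fun t ht => ?_, fun t ht => ?_, hle.trans h4⟩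
    · obtain rfl | hne := eq_or_ne t T
      · simpa using hρC
      · rw [Function.update_of_ne hne]
        exact h2 t (by omega)
    · rw [Function.update_of_ne (by omega)]
      exact h3 t (by omega)
  choose next hnext using step
  let s : ∀ T, {κ // Good T κ} := fun T => Nat.rec
    ⟨μ, fun t => (hμ t).isProbabilityMeasure, fun t ht => absurd ht (Nat.not_lt_zero t),
      fun _ _ => rfl, le_rfl⟩ (fun T κ => ⟨_, hnext T κ.1 κ.2⟩) T
  have hs : ∀ T t, t < T → (s T).1 t = (s (t + 1)).1 t := by
    intro T t ht
    induction T, Nat.succ_le_of_lt ht using Nat.le_induction with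
    | base => rfl
    | succ T hT ih =>
      rw [← ih hT]
      exact Function.update_of_ne (by omega) _ _
  have hprob : ∀ t, IsProbabilityMeasure ((s (t + 1)).1 t) := fun t => (s (t + 1)).2.1 t
  refine ⟨fun t => (s (t + 1)).1 t, fun t => (s (t + 1)).2.2.1 t (Nat.lt_succ_self t), ?_⟩
  rw [hFint]
  -- The first `T` terms involve only coordinates below `T`, where the limiting sequence agrees with
  -- stage `T`.
  refine ENNReal.tsum_le_of_sum_range_le fun T => ?_
  have hprobT : ∀ t, IsProbabilityMeasure ((s T).1 t) := (s T).2.1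
  calc ∑ a ∈ Finset.range T, Measure.infinitePi (fun t => (s (t + 1)).1 t) (A a)
      = ∑ a ∈ Finset.range T, Measure.infinitePi (s T).1 (A a) := by
        refine Finset.sum_congr rfl fun a ha => ?_
        refine infinitePi_congr_cylinderEvents (fun t ht => (hs T t ?_).symm) (hA a)
        exact (Set.mem_Iio.1 ht).trans (Finset.mem_range.1 ha)
    _ ≤ ∑' a, Measure.infinitePi (s T).1 (A a) := ENNReal.sum_le_tsum _
    _ ≤ e := by rw [← hFint]; exact (s T).2.2.2.2

end Mixtures

/-! ### Existence of labels. -/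

section Labels

/-- Enumerate the disjoint union of blocks of sizes `f g` and label each position by its block. -/
theorem exists_card_fiber_eq {ι : Type*} [Fintype ι] [DecidableEq ι] {n : ℕ} {f : ι → ℕ}
    (h : ∑ g, f g = n) :
    ∃ σ : Fin n → ι, ∀ g, (Finset.univ.filter fun i => σ i = g).card = f g := by
  have hcard : Fintype.card (Σ g, Fin (f g)) = n := by simp [h]
  let e := Fintype.equivFinOfCardEq hcard
  refine ⟨fun i => (e.symm i).1, fun g => ?_⟩
  have : (Finset.univ.filter fun i => (e.symm i).1 = g) =
      (Finset.univ : Finset (Fin (f g))).map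
        ((Function.Embedding.sigmaMk g).trans e.toEmbedding) := by
    ext i
    simp only [Finset.mem_filter, Finset.mem_univ, true_and, Finset.mem_map,
      Function.Embedding.trans_apply, Function.Embedding.sigmaMk_apply, Equiv.coe_toEmbedding]
    constructor
    · rintro rfl
      exact ⟨(e.symm i).2, e.apply_symm_apply i⟩
    · rintro ⟨j, rfl⟩
      rw [e.symm_apply_apply]
  rw [this, Finset.card_map, Finset.card_univ, Fintype.card_fin]

theorem labels_nonempty {n K : ℕ} {m : Fin K → ℕ} (hm : ∀ k, 1 ≤ m k) (hn : ∑ k, m k = n)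
    (s : Option (Fin K)) : (labels n m s).Nonempty := by
  have hsum : ∑ g, groupSize m s g = n := by
    rw [Fintype.sum_sum_type, ← Finset.sum_add_distrib, ← hn]
    refine Finset.sum_congr rfl fun k _ => ?_
    have := hm k
    simp only [groupSize]
    split_ifs <;> omega
  obtain ⟨σ, hσ⟩ := exists_card_fiber_eq hsum
  exact ⟨σ, Finset.mem_filter.2 ⟨Finset.mem_univ _, hσ⟩⟩

end Labels

/-! ### Delay and run length as sums of survival indicators. -/

section Delay

variable {X : Type*} {n : ℕ} {τ : (ℕ → Fin n → X) → ℕ∞}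

theorem antitone_lt_stopping : Antitone fun a : ℕ => {x | (a : ℕ∞) < τ x} :=
  fun _ _ hab x (hx : _ < τ x) => (Nat.cast_le.2 hab).trans_lt hx

/-- Index `a` is time `a + 1`, so a change at index `a` means `ν = a + 1`; truncating to `M` terms
leaves finitely many coordinates. -/
theorem sum_indicator_le_delay (a M : ℕ) (x : ℕ → Fin n → X) :
    ∑ j ∈ Finset.range M, {x | ((a + (j + 1) : ℕ) : ℕ∞) < τ x}.indicator (1 : (ℕ → Fin n → X) → ℝ≥0∞) x ≤
      delay τ (a + 1) x := by
  unfold delay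
  rcases hx : τ x with _ | N
  · have : ENat.toENNReal none = ∞ := rfl
    rw [this, ENNReal.top_sub (ENNReal.natCast_ne_top _)]
    exact le_top
  · have hN : ENat.toENNReal (some N) = (N : ℝ≥0∞) := rfl
    have hlt : ∀ j, x ∈ {x | ((a + (j + 1) : ℕ) : ℕ∞) < τ x} ↔ a + (j + 1) < N := fun j => by
      rw [Set.mem_ofPred_eq, hx]
      exact Nat.cast_lt (α := ℕ∞)
    classical
    simp_rw [Set.indicator_apply, hlt, Pi.one_apply]
    rw [hN, ← Finset.sum_filter, Finset.sum_const, nsmul_one, ← ENNReal.natCast_sub, Nat.cast_le]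
    refine (Finset.card_le_card fun j hj => ?_).trans_eq (Finset.card_range (N - (a + 1)))
    have := (Finset.mem_filter.1 hj).2
    exact Finset.mem_range.2 (by omega)

theorem toENNReal_le_tsum_indicator (x : ℕ → Fin n → X) :
    (τ x : ℝ≥0∞) ≤ ∑' a : ℕ, {x | (a : ℕ∞) < τ x}.indicator (1 : (ℕ → Fin n → X) → ℝ≥0∞) x := by
  have hsum : ∀ N : ℕ, (N : ℕ∞) ≤ τ x →
      (N : ℝ≥0∞) ≤ ∑' a : ℕ, {x | (a : ℕ∞) < τ x}.indicator (1 : (ℕ → Fin n → X) → ℝ≥0∞) x := by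
    intro N hN
    refine le_trans ?_ (ENNReal.sum_le_tsum (Finset.range N))
    have : ∀ a ∈ Finset.range N,
        {x | (a : ℕ∞) < τ x}.indicator (1 : (ℕ → Fin n → X) → ℝ≥0∞) x = 1 := fun a ha =>
      Set.indicator_of_mem (show x ∈ {x | (a : ℕ∞) < τ x} from
        (Nat.cast_lt.2 (Finset.mem_range.1 ha)).trans_le hN) _
    rw [Finset.sum_congr rfl this]
    simp
  rcases hx : τ x with _ | N
  · have : ENat.toENNReal none = ∞ := rfl
    rw [this, top_le_iff]
    refine ENNReal.eq_top_of_forall_nnreal_le fun r => ?_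
    obtain ⟨N, hN⟩ := exists_nat_ge r
    refine le_trans ?_ (hsum N (hx ▸ le_top))
    exact_mod_cast hN
  · exact hsum N hx.ge

end Delay

/-! ### Reduction to the simple problem. -/

noncomputable section Reduction

variable {X : Type*} [MeasurableSpace X] {n K : ℕ} {p : Fin 2 → Fin K → Measure X}
  {m : Fin K → ℕ}

theorem isProbabilityMeasure_labelDist (hp : ∀ θ k, IsProbabilityMeasure (p θ k))
    (σ : Fin n → Fin K ⊕ Fin K) : IsProbabilityMeasure (labelDist p σ) := by
  have : ∀ i, IsProbabilityMeasure (groupDist p (σ i)) := fun i => by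
    rcases σ i with k | k
    · exact hp 0 k
    · exact hp 1 k
  unfold labelDist
  infer_instance

/-- The distributions of the sample vector over all labels, with or without an anomaly. -/
def labelDists (n : ℕ) (p : Fin 2 → Fin K → Measure X) (m : Fin K → ℕ) (anomaly : Prop) :
    Set (Measure (Fin n → X)) :=
  {ρ | ∃ s : Option (Fin K), (s ≠ none ↔ anomaly) ∧ ∃ σ ∈ labels n m s, labelDist p σ = ρ}

theorem mixture_eq_sum (s : Option (Fin K)) :
    mixture n p m s = ∑ σ : Fin n → Fin K ⊕ Fin K,
      (if σ ∈ labels n m s then ((labels n m s).card : ℝ≥0∞)⁻¹ else 0) • labelDist p σ := by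
  simp_rw [ite_smul, zero_smul]
  rw [Finset.sum_ite_mem, Finset.univ_inter, mixture, Finset.smul_sum]

theorem sum_mixture_weights (hm : ∀ k, 1 ≤ m k) (hn : ∑ k, m k = n) (s : Option (Fin K)) :
    ∑ σ : Fin n → Fin K ⊕ Fin K,
      (if σ ∈ labels n m s then ((labels n m s).card : ℝ≥0∞)⁻¹ else 0) = 1 := by
  rw [Finset.sum_ite_mem, Finset.univ_inter, Finset.sum_const, nsmul_eq_mul]
  exact ENNReal.mul_inv_cancel
    (Nat.cast_ne_zero.2 (labels_nonempty hm hn s).card_ne_zero) (ENNReal.natCast_ne_top _)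

theorem isMixture_mixture (hm : ∀ k, 1 ≤ m k) (hn : ∑ k, m k = n)
    (hp : ∀ θ k, IsProbabilityMeasure (p θ k)) :
    IsMixture (labelDists n p m False) (mixture n p m none) := by
  refine ⟨_, inferInstance, _, _, isProbabilityMeasure_labelDist hp, fun σ hσ => ?_,
    sum_mixture_weights hm hn none, mixture_eq_sum none⟩
  exact ⟨none, by simp, σ, by_contra fun h => hσ (if_neg h), rfl⟩

theorem isMixture_weightedMixture (hm : ∀ k, 1 ≤ m k) (hn : ∑ k, m k = n)
    (hp : ∀ θ k, IsProbabilityMeasure (p θ k)) {β : Fin K → ℝ}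
    (hβ : β ∈ stdSimplex ℝ (Fin K)) :
    IsMixture (labelDists n p m True) (weightedMixture n p m β) := by
  refine ⟨Fin K × (Fin n → Fin K ⊕ Fin K), inferInstance,
    fun z => ENNReal.ofReal (β z.1) * (if z.2 ∈ labels n m (some z.1) then
      ((labels n m (some z.1)).card : ℝ≥0∞)⁻¹ else 0), fun z => labelDist p z.2,
    fun z => isProbabilityMeasure_labelDist hp z.2, fun z hz => ?_, ?_, ?_⟩
  · exact ⟨some z.1, by simp, z.2, by_contra fun h => hz (by simp [h]), rfl⟩
  · rw [Fintype.sum_prod_type]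
    simp_rw [← Finset.mul_sum, sum_mixture_weights hm hn, mul_one]
    rw [← ENNReal.ofReal_sum_of_nonneg fun k _ => hβ.1 k, hβ.2, ENNReal.ofReal_one]
  · rw [Fintype.sum_prod_type, weightedMixture]
    simp_rw [mixture_eq_sum, Finset.smul_sum, smul_smul]

variable {τ : (ℕ → Fin n → X) → ℕ∞}

theorem measurableSet_lt_stopping (hτ : IsStoppingTime (hist X n) τ) (a : ℕ) :
    MeasurableSet[cylinderEvents (X := fun _ => Fin n → X) (Set.Iio a)]
      {x | (a : ℕ∞) < τ x} := by
  have : {x | (a : ℕ∞) < τ x} = {x | τ x ≤ (a : ℕ∞)}ᶜ := by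
    ext x; simp
  rw [this]
  exact MeasurableSet.compl (hτ a)

theorem WARL_le_tsum (hm : ∀ k, 1 ≤ m k) (hn : ∑ k, m k = n)
    (hp : ∀ θ k, IsProbabilityMeasure (p θ k)) (hτ : IsStoppingTime (hist X n) τ) :
    WARL p m τ ≤
      ∑' a : ℕ, Measure.infinitePi (fun _ : ℕ => mixture n p m none) {x | (a : ℕ∞) < τ x} := by
  obtain ⟨μ, hμ, hle⟩ := exists_tsum_infinitePi_le (μ := fun _ => mixture n p m none)
    (C := fun _ => labelDists n p m False) (fun _ => isMixture_mixture hm hn hp)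
    (measurableSet_lt_stopping hτ)
  refine le_trans ?_ hle
  choose s hs Ω hΩ hμΩ using hμ
  have hs' : ∀ t, s t = none := fun t => by simpa using hs t
  refine (iInf₂_le Ω fun t => hs' t ▸ hΩ t).trans ?_
  have hlaw : law p Ω = Measure.infinitePi μ := congrArg _ (funext hμΩ)
  rw [hlaw]
  refine (lintegral_mono toENNReal_le_tsum_indicator).trans_eq ?_
  have hAm : ∀ a : ℕ, MeasurableSet {x | (a : ℕ∞) < τ x} := fun a =>
    cylinderEvents_le_pi _ (measurableSet_lt_stopping hτ a)
  rw [lintegral_tsum fun a => (measurable_one.indicator (hAm a)).aemeasurable]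
  exact tsum_congr fun a => lintegral_indicator_one (hAm a)

/-- The essential supremum is traded for an integrated inequality, whose two sides are linear in the
law and can therefore be mixed. -/
theorem setLIntegral_delay_le_WADD (hp : ∀ θ k, IsProbabilityMeasure (p θ k)) (a : ℕ)
    {S : ℕ → Option (Fin K)} (hS : IsTrajectory (a + 1) S) {Ω : ℕ → Fin n → Fin K ⊕ Fin K}
    (hΩ : ∀ t, Ω t ∈ labels n m (S t)) {B : Set (ℕ → Fin n → X)}
    (hB : MeasurableSet[hist X n a] B) :
    ∫⁻ x in B, delay τ (a + 1) x ∂law p Ω ≤ WADD p m τ * law p Ω B := by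
  have : ∀ t, IsProbabilityMeasure (labelDist p (Ω t)) := fun t =>
    isProbabilityMeasure_labelDist hp _
  have : IsProbabilityMeasure (law p Ω) := by unfold law; infer_instance
  have hess : essSup (condLExp (hist X n a) (law p Ω) (delay τ (a + 1))) (law p Ω) ≤
      WADD p m τ := by
    unfold WADD
    exact le_iSup₂_of_le (a + 1) (Nat.le_add_left 1 a) (le_iSup₂_of_le S hS
      (le_iSup₂_of_le Ω hΩ le_rfl))
  rw [← setLIntegral_condLExp ((hist X n).le a) (law p Ω) _ hB, ← setLIntegral_const]
  refine lintegral_mono_ae (ae_restrict_of_ae ?_)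
  filter_upwards [ENNReal.ae_le_essSup
    (condLExp (hist X n a) (law p Ω) (delay τ (a + 1)))] with x hx using hx.trans hess

theorem sum_changeAt_le_WADD (hm : ∀ k, 1 ≤ m k) (hn : ∑ k, m k = n)
    (hp : ∀ θ k, IsProbabilityMeasure (p θ k)) {β : Fin K → ℝ}
    (hβ : β ∈ stdSimplex ℝ (Fin K)) (hτ : IsStoppingTime (hist X n) τ)
    (a M : ℕ) :
    ∑ j ∈ Finset.range M, Measure.infinitePi
        (changeAt (mixture n p m none) (weightedMixture n p m β) a)
        {x | ((a + (j + 1) : ℕ) : ℕ∞) < τ x} ≤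
      WADD p m τ * Measure.infinitePi
        (changeAt (mixture n p m none) (weightedMixture n p m β) a) {x | (a : ℕ∞) < τ x} := by
  have hAm : ∀ a : ℕ, MeasurableSet {x | (a : ℕ∞) < τ x} := fun a =>
    cylinderEvents_le_pi _ (measurableSet_lt_stopping hτ a)
  have hAT : ∀ b ≤ a + M, MeasurableSet[cylinderEvents (X := fun _ => Fin n → X)
      (Set.Iio (a + M))] {x | (b : ℕ∞) < τ x} := fun b hb =>
    cylinderEvents_mono (Set.Iio_subset_Iio hb) _ (measurableSet_lt_stopping hτ b)
  have hF : ∀ ρ : Measure (ℕ → Fin n → X),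
      ∑ j ∈ Finset.range M, ρ {x | ((a + (j + 1) : ℕ) : ℕ∞) < τ x} =
      ∫⁻ x, ∑ j ∈ Finset.range M,
        {x | ((a + (j + 1) : ℕ) : ℕ∞) < τ x}.indicator (1 : (ℕ → Fin n → X) → ℝ≥0∞) x ∂ρ := fun ρ => by
    rw [lintegral_finsetSum _ fun j _ => measurable_one.indicator (hAm _)]
    exact Finset.sum_congr rfl fun j _ => (lintegral_indicator_one (hAm _)).symm
  have hG : ∀ ρ : Measure (ℕ → Fin n → X),
      WADD p m τ * ρ {x | (a : ℕ∞) < τ x} =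
      ∫⁻ x, {x | (a : ℕ∞) < τ x}.indicator (fun _ => WADD p m τ) x ∂ρ := fun ρ => by
    rw [lintegral_indicator_const (hAm a)]
  rw [hF, hG]
  refine lintegral_le_of_forall_isMixture (T := a + M)
    (C := fun t => labelDists n p m (a ≤ t)) (fun t ρ hρ => ?_) (fun t => ?_) ?_ ?_ ?_
  · obtain ⟨_, -, σ, -, rfl⟩ := hρ
    exact isProbabilityMeasure_labelDist hp σ
  · unfold changeAt
    by_cases h : t < a
    · simpa [h, h.not_ge] using isMixture_mixture hm hn hp
    · simpa [h, not_lt.1 h] using isMixture_weightedMixture hm hn hp hβ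
  · refine Finset.measurable_fun_sum _ fun j hj => ?_
    have := Finset.mem_range.1 hj
    exact Measurable.indicator (f := fun _ => (1 : ℝ≥0∞)) measurable_const
      (hAT (a + (j + 1)) (by omega))
  · exact measurable_const.indicator (hAT a (Nat.le_add_right _ _))
  · intro μ hμ
    -- Component choices at the separate times form one admissible trajectory with labels, because
    -- types may vary arbitrarily after the change.
    choose S hS Ω hΩ hμΩ using hμ
    have hlaw : law p Ω = Measure.infinitePi μ := congrArg _ (funext hμΩ)
    have htraj : IsTrajectory (a + 1) S := fun t => by
      have := hS t
      rw [Nat.add_lt_add_iff_right, ← not_le, ← this, not_not]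
    rw [← hG, ← hlaw]
    refine le_trans ?_ (setLIntegral_delay_le_WADD hp a htraj hΩ
      (measurableSet_lt_stopping hτ a))
    rw [← lintegral_indicator (hAm a)]
    refine lintegral_mono fun x => ?_
    by_cases hx : x ∈ {x | (a : ℕ∞) < τ x}
    · rw [Set.indicator_of_mem hx]
      exact sum_indicator_le_delay a M x
    · rw [Set.indicator_of_notMem hx]
      refine (Finset.sum_eq_zero fun j _ => Set.indicator_of_notMem (fun hj => hx ?_) _).le
      exact antitone_lt_stopping (Nat.le_add_right a (j + 1)) hj

end Reduction

/-! ### Asymptotics of the explicit bound. -/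

noncomputable section Asymptotics

/-- The horizon over which a change is to be detected. -/
def horizon (γ : ℝ) : ℕ := ⌈Real.log γ ^ 2⌉₊

/-- The non-asymptotic lower bound on the delay, for divergence `I`. -/
def delayBound (I γ : ℝ) : ℝ :=
  (Real.log (γ / (2 * horizon γ)) - I - 1) / (I + Real.log (γ / (2 * horizon γ)) / horizon γ)

theorem horizon_le {γ : ℝ} (h : 1 ≤ Real.log γ) : (horizon γ : ℝ) ≤ 2 * Real.log γ ^ 2 := by
  have := Nat.ceil_lt_add_one (sq_nonneg (Real.log γ))
  unfold horizon
  nlinarith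

theorem le_horizon (γ : ℝ) : Real.log γ ^ 2 ≤ horizon γ := Nat.le_ceil _

theorem tendsto_log_horizon_div_log :
    Tendsto (fun γ => Real.log (2 * horizon γ) / Real.log γ) atTop (𝓝 0) := by
  have hlim : Tendsto (fun L : ℝ => Real.log 4 / L + 2 * (Real.log L / L)) atTop (𝓝 0) := by
    have h1 : Tendsto (fun L : ℝ => Real.log L / L) atTop (𝓝 0) :=
      Real.isLittleO_log_id_atTop.tendsto_div_nhds_zero
    simpa using (tendsto_const_nhds.div_atTop tendsto_id).add (h1.const_mul 2)
  refine squeeze_zero' ?_ ?_ (hlim.comp Real.tendsto_log_atTop)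
  all_goals
    filter_upwards [Real.tendsto_log_atTop.eventually_ge_atTop 1] with γ hγ
    have h1 : (1 : ℝ) ≤ horizon γ := le_trans (by nlinarith) (le_horizon γ)
  · exact div_nonneg (Real.log_nonneg (by linarith)) (by linarith)
  · have hL : 0 < Real.log γ := by linarith
    have : Real.log (2 * horizon γ) ≤ Real.log 4 + 2 * Real.log (Real.log γ) := by
      rw [show (2 : ℝ) * Real.log (Real.log γ) = Real.log (Real.log γ ^ 2) by
        rw [Real.log_pow]; norm_num, ← Real.log_mul (by norm_num) (by positivity)]
      exact Real.log_le_log (by linarith) (by linarith [horizon_le hγ])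
    simp only [Function.comp]
    calc Real.log (2 * horizon γ) / Real.log γ
        ≤ (Real.log 4 + 2 * Real.log (Real.log γ)) / Real.log γ := by gcongr
      _ = _ := by ring

theorem eventually_horizon_le : ∀ᶠ γ in atTop, 0 < horizon γ ∧ 2 * (horizon γ : ℝ) ≤ γ := by
  filter_upwards [Real.tendsto_log_atTop.eventually_ge_atTop 1,
    tendsto_log_horizon_div_log.eventually_le_const zero_lt_one, eventually_gt_atTop 0]
    with γ hγ h1 h0
  have hpos : (0 : ℝ) < horizon γ := lt_of_lt_of_le (by positivity) (le_horizon γ)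
  refine ⟨Nat.cast_pos.1 hpos, ?_⟩
  rw [div_le_one (by linarith)] at h1
  exact (Real.log_le_log_iff (by linarith) h0).1 h1

/-- A horizon of order `(log γ)²` is small enough to cost only a `log log γ` term in the level, yet
large enough that `log γ / horizon γ` vanishes. -/
theorem tendsto_delayBound_div_log {I : ℝ} (hI : 0 < I) :
    Tendsto (fun γ => I * delayBound I γ / Real.log γ) atTop (𝓝 1) := by
  have hlog := Real.tendsto_log_atTop
  have hc : Tendsto (fun γ => Real.log (γ / (2 * horizon γ)) / Real.log γ) atTop (𝓝 1) := by
    have := tendsto_log_horizon_div_log.const_sub 1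
    rw [sub_zero] at this
    refine this.congr' ?_
    filter_upwards [hlog.eventually_ge_atTop 1, eventually_horizon_le, eventually_gt_atTop 0]
      with γ hγ h1 h0
    have : (0 : ℝ) < horizon γ := Nat.cast_pos.2 h1.1
    rw [Real.log_div h0.ne' (by positivity), sub_div, div_self (by linarith)]
  have hM : Tendsto (fun γ => Real.log γ / horizon γ) atTop (𝓝 0) := by
    refine squeeze_zero' ?_ ?_ (tendsto_inv_atTop_zero.comp hlog)
    all_goals
      filter_upwards [hlog.eventually_ge_atTop 1] with γ hγ
    · exact div_nonneg (by linarith) (Nat.cast_nonneg _)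
    · have := le_horizon γ
      have hL : 0 < Real.log γ := by linarith
      have hpos : (0 : ℝ) < horizon γ := lt_of_lt_of_le (by positivity) this
      rw [Function.comp, inv_eq_one_div, div_le_div_iff₀ hpos hL]
      linarith [sq (Real.log γ)]
  have hcM := hc.mul hM
  have hinv : Tendsto (fun γ => (I + 1) / Real.log γ) atTop (𝓝 0) :=
    tendsto_const_nhds.div_atTop hlog
  have := ((hc.sub hinv).const_mul I).div (hcM.const_add I) (by simpa using hI.ne')
  simp only [sub_zero, mul_one, mul_zero, add_zero, div_self hI.ne'] at this
  refine this.congr' ?_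
  filter_upwards [hlog.eventually_ge_atTop 1] with γ hγ
  have hL : Real.log γ ≠ 0 := by linarith
  simp only [Pi.div_apply]
  unfold delayBound
  rw [div_mul_div_cancel₀ hL]
  field_simp
  ring

end Asymptotics

/-! ### Assembly. -/

variable {X : Type*} [MeasurableSpace X] {n K : ℕ} {p : Fin 2 → Fin K → Measure X}
  {m : Fin K → ℕ} {τ : (ℕ → Fin n → X) → ℕ∞}

/-- `delayBound` is what results from solving the inequality of `delay_bound` for `D`. -/
theorem delayBound_le_WADD (hm : ∀ k, 1 ≤ m k) (hn : ∑ k, m k = n)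
    (hp : ∀ θ k, IsProbabilityMeasure (p θ k)) {β : Fin K → ℝ}
    (hβ : β ∈ stdSimplex ℝ (Fin K)) (hpos : 0 < weightedDiv n p m β)
    (hfin : weightedDiv n p m β ≠ ∞) (hτ : IsStoppingTime (hist X n) τ) {γ : ℝ}
    (hM : 0 < horizon γ) (hγM : 2 * (horizon γ : ℝ) ≤ γ)
    (hγ : ENNReal.ofReal γ ≤ WARL p m τ) :
    ENNReal.ofReal (delayBound (weightedDiv n p m β).toReal γ) ≤ WADD p m τ := by
  by_cases htop : WADD p m τ = ∞
  · simp [htop]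
  have hP₀ : IsProbabilityMeasure (mixture n p m none) :=
    (isMixture_mixture hm hn hp).isProbabilityMeasure
  have hP₁ : IsProbabilityMeasure (weightedMixture n p m β) :=
    (isMixture_weightedMixture hm hn hp hβ).isProbabilityMeasure
  obtain ⟨hac, hint⟩ := InformationTheory.klDiv_ne_top_iff.1 hfin
  have hI : (weightedDiv n p m β).toReal =
      ∫ y, llr (weightedMixture n p m β) (mixture n p m none) y ∂weightedMixture n p m β :=
    InformationTheory.toReal_klDiv_of_measure_eq hac (by simp)
  have hIpos : 0 < (weightedDiv n p m β).toReal := ENNReal.toReal_pos hpos.ne' hfin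
  have key := delay_bound hac hint (hI ▸ hIpos.le) (measurableSet_lt_stopping hτ)
    antitone_lt_stopping (D := (WADD p m τ).toReal) hM (fun a => ?_) hγM
    (hγ.trans (WARL_le_tsum hm hn hp hτ))
  · rw [← hI] at key
    refine ENNReal.ofReal_le_of_le_toReal ?_
    have hM' : (0 : ℝ) < horizon γ := Nat.cast_pos.2 hM
    have hc : 0 ≤ Real.log (γ / (2 * horizon γ)) :=
      Real.log_nonneg ((one_le_div (by positivity)).2 hγM)
    rw [delayBound, div_le_iff₀ (by positivity)]
    have : Real.log (γ / (2 * horizon γ)) * ((WADD p m τ).toReal / horizon γ) =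
      (WADD p m τ).toReal * (Real.log (γ / (2 * horizon γ)) / horizon γ) := by ring
    linarith
  · have h := sum_changeAt_le_WADD hm hn hp hβ hτ a (horizon γ)
    have h' := ENNReal.toReal_mono (ENNReal.mul_ne_top htop (measure_ne_top _ _)) h
    rw [ENNReal.toReal_sum fun j _ => measure_ne_top _ _, ENNReal.toReal_mul] at h'
    exact h'

end UnlabeledQCD

theorem theorem4 {X : Type*} [MeasurableSpace X] {n K : ℕ}
    (m : Fin K → ℕ) (hm : ∀ k, 1 ≤ m k) (hn : ∑ k, m k = n)
    (p : Fin 2 → Fin K → Measure X) (hp : ∀ θ k, IsProbabilityMeasure (p θ k))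
    (β : Fin K → ℝ) (hβ : β ∈ stdSimplex ℝ (Fin K))
    (hmin : IsMinOn (UnlabeledQCD.weightedDiv n p m) (stdSimplex ℝ (Fin K)) β)
    (hpos : 0 < UnlabeledQCD.weightedDiv n p m β) :
    ∃ r : ℝ → ℝ, r =o[atTop] (fun _ => (1 : ℝ)) ∧
      ∀ᶠ γ : ℝ in atTop,
        ENNReal.ofReal (Real.log γ * (1 + r γ)) / UnlabeledQCD.weightedDiv n p m β ≤
          ⨅ (τ : (ℕ → Fin n → X) → ℕ∞) (_ : IsStoppingTime (UnlabeledQCD.hist X n) τ)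
            (_ : ENNReal.ofReal γ ≤ UnlabeledQCD.WARL p m τ), UnlabeledQCD.WADD p m τ := by
  by_cases hfin : UnlabeledQCD.weightedDiv n p m β = ∞
  · exact ⟨0, Asymptotics.isLittleO_zero _ _, Eventually.of_forall fun γ => by simp [hfin]⟩
  set I := (UnlabeledQCD.weightedDiv n p m β).toReal with hI
  have hIpos : 0 < I := ENNReal.toReal_pos hpos.ne' hfin
  -- Chosen so that `log γ * (1 + r γ) / I` is exactly `delayBound I γ`; it does not involve `τ`.
  refine ⟨fun γ => I * UnlabeledQCD.delayBound I γ / Real.log γ - 1, ?_, ?_⟩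
  · rw [Asymptotics.isLittleO_one_iff]
    simpa using (UnlabeledQCD.tendsto_delayBound_div_log hIpos).sub_const 1
  · filter_upwards [UnlabeledQCD.eventually_horizon_le,
      Real.tendsto_log_atTop.eventually_gt_atTop 0] with γ hγ hlog
    refine le_iInf₂ fun τ hτ => le_iInf fun hWARL => ?_
    have hle := UnlabeledQCD.delayBound_le_WADD hm hn hp hβ hpos hfin hτ hγ.1 hγ.2 hWARL
    rw [add_sub_cancel, mul_div_cancel₀ _ hlog.ne', ENNReal.ofReal_mul hIpos.le, hI,
      ENNReal.ofReal_toReal hfin, mul_comm, ENNReal.mul_div_cancel_right hpos.ne' hfin]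
    exact hle
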